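/- A group $G$ is called a Jordan group if there is an integer $d>0$ such that every finite subgroup $H$ of $G$ contains a normal abelian subgroup whose index in $H$ is at most $d$; the least such $d$ is the Jordan constant $J_G$ of $G$. Let $p$ be a prime number, and let $D=D_{p,\infty}$ be the quaternion algebra over $\mathbb{Q}$ (that is, the central simple $\mathbb{Q}$-algebra of dimension $4$), unique up to isomorphism, that is ramified exactly at the places $p$ and $\infty$: $D\otimes_{\mathbb{Q}}\mathbb{R}$ is a division algebra, and, for a prime $\ell$, $D\otimes_{\mathbb{Q}}\mathbb{Q}_\ell$ is a division algebra if and only if $\ell=p$. Then the multiplicative group $D^\times$ is a Jordan group, and $$J_{D^\times}=\begin{cases}12 & \text{if and only if } p=2;\\ 2 & \text{if and only if } p=3;\\ 1 & \text{if and only if } p\ge 5.\end{cases}$$ -/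

import Mathlib

open scoped TensorProduct

/-- The natural number `d` is a Jordan bound for the group `G`: it is positive, and every finite
subgroup `H` of `G` contains a normal abelian subgroup whose index in `H` is at most `d`. -/
def IsJordanBound (G : Type*) [Group G] (d : ℕ) : Prop :=
  0 < d ∧ ∀ H : Subgroup G, Finite H →
    ∃ N : Subgroup H, N.Normal ∧ (∀ x ∈ N, ∀ y ∈ N, x * y = y * x) ∧ N.index ≤ d

/-- A Jordan group: one that has a Jordan bound. -/
def IsJordanGroup (G : Type*) [Group G] : Prop :=
  ∃ d : ℕ, IsJordanBound G d

/-- The Jordan constant of `G`: its least Jordan bound (meaningful for a Jordan group `G`;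
the value is `0` otherwise). -/
noncomputable def jordanConstant (G : Type*) [Group G] : ℕ :=
  sInf {d : ℕ | IsJordanBound G d}

/-- A quaternion algebra over a field `F`: a central simple `F`-algebra of dimension `4`. -/
structure IsQuaternionAlgebra (F D : Type*) [Field F] [Ring D] [Algebra F D] : Prop where
  isCentral : Algebra.IsCentral F D
  isSimpleRing : IsSimpleRing D
  finrank_eq_four : Module.finrank F D = 4

/-- For a completion `K` of `ℚ`, the algebra `D` over `ℚ` is ramified at the place given by `K`
if `K ⊗ D` is a division algebra. (A quaternion algebra is split there otherwise.) -/
def IsRamifiedOver (K D : Type*) [Field K] [Algebra ℚ K] [Ring D] [Algebra ℚ D] : Prop :=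
  Nontrivial (K ⊗[ℚ] D) ∧ ∀ x : K ⊗[ℚ] D, x ≠ 0 → IsUnit x

/-- `D` is (a copy of) `D_{p,∞}`: a quaternion algebra over `ℚ` whose set of ramified places
is exactly `{p, ∞}`. -/
structure IsQuaternionRamifiedAtPInfty (p : ℕ) (D : Type*) [Ring D] [Algebra ℚ D] : Prop where
  isQuaternionAlgebra : IsQuaternionAlgebra ℚ D
  ramified_infty : IsRamifiedOver ℝ D
  ramified_prime_iff : ∀ (l : ℕ) [Fact l.Prime], IsRamifiedOver ℚ_[l] D ↔ l = p

/-!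
Let `H` be a finite subgroup of `Dˣ`. Since `D` is definite, the elements of `H` have reduced norm
`1` and the reduced trace `τ` takes integer values in `[-2, 2]` on `H`, with the value `2` only
at `1`. For noncommuting `x` and `y`, the elements `x - x⁻¹` and `x * y - y * x` anticommute and
present `D` as the quaternion algebra `(τ x ^ 2 - 4, τ ⁅x, y⁆ - 2)` over `ℚ`, whereas Fricke's
formula leaves only `-2`, `-1` and `0` for the value of `τ ⁅x, y⁆`. Ramification at `p` excludes
all three values if `5 ≤ p`, all but `-1` if `p = 3`, and `-1` if `p = 2`. Hence, respectively,
`H` is abelian, the elements of nonzero trace form an abelian subgroup of index at most `2`, or the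
elements of trace `±2` form a central subgroup of index at most `12`.

Conversely, Legendre's descent on a presentation `(-a, -b)` with `a + b` minimal identifies `D` with
`(-1, -1)` for `p = 2` and with `(-1, -3)` for `p = 3`. The `24` Hurwitz units of the former and a
dicyclic group of order `12` in the latter attain the bounds.
-/

open scoped Quaternion commutatorElement
open QuaternionAlgebra (Basis)

section NormForm

variable {R : Type*} [CommRing R] {a b : R}

/-- The reduced norm `x ↦ x * star x` of the quaternion algebra `ℍ[R,a,0,b]`. -/
def reducedNorm : ℍ[R,a,0,b] →* R where
  toFun x := x.re ^ 2 - a * x.imI ^ 2 - b * x.imJ ^ 2 + a * b * x.imK ^ 2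
  map_one' := by simp
  map_mul' x y := by
    simp only [QuaternionAlgebra.re_mul, QuaternionAlgebra.imI_mul, QuaternionAlgebra.imJ_mul,
      QuaternionAlgebra.imK_mul]
    ring

lemma reducedNorm_apply (x : ℍ[R,a,0,b]) :
    reducedNorm x = x.re ^ 2 - a * x.imI ^ 2 - b * x.imJ ^ 2 + a * b * x.imK ^ 2 := rfl

lemma mul_star_eq_reducedNorm (x : ℍ[R,a,0,b]) :
    x * star x = algebraMap R _ (reducedNorm x) := by
  rw [QuaternionAlgebra.algebraMap_eq]
  ext <;> simp [reducedNorm_apply] <;> ring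

lemma star_mul_eq_reducedNorm (x : ℍ[R,a,0,b]) :
    star x * x = algebraMap R _ (reducedNorm x) := by
  rw [QuaternionAlgebra.algebraMap_eq]
  ext <;> simp [reducedNorm_apply] <;> ring

/-- The reduced norm form `⟨1, -a, -b, ab⟩` of the quaternion algebra `ℍ[R,a,0,b]` is
anisotropic. -/
def NormAnisotropic (a b : R) : Prop :=
  ∀ x : ℍ[R,a,0,b], reducedNorm x = 0 → x = 0

lemma not_normAnisotropic (r x y z : R) (hne : ¬(r = 0 ∧ x = 0 ∧ y = 0 ∧ z = 0))
    (h : r ^ 2 - a * x ^ 2 - b * y ^ 2 + a * b * z ^ 2 = 0) : ¬ NormAnisotropic a b :=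
  fun haniso ↦ hne (by simpa [QuaternionAlgebra.ext_iff] using haniso ⟨r, x, y, z⟩ h)

lemma forall_isUnit_iff_normAnisotropic {F : Type*} [Field F] {a b : F} :
    (∀ x : ℍ[F,a,0,b], x ≠ 0 → IsUnit x) ↔ NormAnisotropic a b := by
  refine ⟨fun h x hx ↦ ?_, fun h x hx ↦ ?_⟩
  · by_contra hne
    exact ((h x hne).map reducedNorm).ne_zero hx
  · have hnorm : reducedNorm x ≠ 0 := mt (h x) hx
    have hunit := (IsUnit.mk0 _ hnorm).map (algebraMap F ℍ[F,a,0,b])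
    have hcomm : Commute x (star x) :=
      (mul_star_eq_reducedNorm x).trans (star_mul_eq_reducedNorm x).symm
    exact (hcomm.isUnit_mul_iff.mp (mul_star_eq_reducedNorm x ▸ hunit)).1

end NormForm

section Presentation

variable {F : Type*} [Field F] [NeZero (2 : F)] {α β : F}

/-- `4αβ (re x)` is the combination `β(αx + ixi) + j(αx + ixi)j` of products of `x`, so an element
of the kernel has zero real part, as have its products with `i`, `j` and `k`. -/
lemma algHom_injective_of_ne_zero {A : Type*} [Ring A] [Nontrivial A] [Algebra F A] (hα : α ≠ 0)
    (hβ : β ≠ 0) (f : ℍ[F,α,0,β] →ₐ[F] A) : Function.Injective f := by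
  have h2 : (2 : F) ≠ 0 := NeZero.ne 2
  have re_eq_zero (x : ℍ[F,α,0,β]) (hx : f x = 0) : x.re = 0 := by
    let i : ℍ[F,α,0,β] := ⟨0, 1, 0, 0⟩
    let j : ℍ[F,α,0,β] := ⟨0, 0, 1, 0⟩
    have key : (2 * 2 * α * β * x.re) • (1 : ℍ[F,α,0,β]) =
        β • (α • x + i * x * i) + j * (α • x + i * x * i) * j := by
      ext <;> simp [i, j] <;> ring
    have := congrArg f key
    simp only [map_add, map_smul, map_mul, map_one, hx] at this
    simpa [hα, hβ, h2] using this
  refine (injective_iff_map_eq_zero f).mpr fun x hx ↦ ?_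
  have hmul (y) : (x * y).re = 0 := re_eq_zero _ (by rw [map_mul, hx, zero_mul])
  have hi : α * x.imI = 0 := by simpa using hmul ⟨0, 1, 0, 0⟩
  have hj : β * x.imJ = 0 := by simpa using hmul ⟨0, 0, 1, 0⟩
  have hk : α * β * x.imK = 0 := by simpa using hmul ⟨0, 0, 0, 1⟩
  ext <;> simp_all

lemma nonempty_algEquiv_of_basis {A : Type*} [Ring A] [Algebra F A] (hα : α ≠ 0)
    (hβ : β ≠ 0) (hA : Module.finrank F A = 4) (q : Basis A α 0 β) :
    Nonempty (ℍ[F,α,0,β] ≃ₐ[F] A) := by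
  have : Nontrivial A := Module.nontrivial_of_finrank_pos (R := F) (by omega)
  have : FiniteDimensional F A := .of_finrank_pos (by omega)
  have hinj := algHom_injective_of_ne_zero hα hβ q.liftHom
  have hfin : Module.finrank F ℍ[F,α,0,β] = Module.finrank F A := by
    rw [hA, QuaternionAlgebra.finrank_eq_four]
  exact ⟨.ofBijective q.liftHom
    ⟨hinj, (LinearMap.injective_iff_surjective_of_finrank_eq_finrank hfin
      (f := q.liftHom.toLinearMap)).mp hinj⟩⟩

end Presentation

/-- The presentation of `K ⊗ A` obtained from one of `A` by extension of scalars. -/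
def basisBaseChange {F A : Type*} (K : Type*) [CommRing F] [CommRing K] [Algebra F K] [Ring A]
    [Algebra F A] {α β : F} (q : Basis A α 0 β) :
    Basis (K ⊗[F] A) (algebraMap F K α) 0 (algebraMap F K β) where
  i := 1 ⊗ₜ q.i
  j := 1 ⊗ₜ q.j
  k := 1 ⊗ₜ q.k
  i_mul_i := by
    simp [Algebra.TensorProduct.one_def, TensorProduct.smul_tmul', Algebra.algebraMap_eq_smul_one]
  j_mul_j := by
    simp [Algebra.TensorProduct.one_def, TensorProduct.smul_tmul', Algebra.algebraMap_eq_smul_one]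
  i_mul_j := by simp
  j_mul_i := by simp [TensorProduct.tmul_neg]

section Ramification

variable {K D : Type*} [Field K] [Algebra ℚ K] [Ring D] [Algebra ℚ D] {α β : ℚ}

lemma isRamifiedOver_iff_normAnisotropic (hα : α ≠ 0) (hβ : β ≠ 0)
    (hD : Module.finrank ℚ D = 4) (q : Basis D α 0 β) :
    IsRamifiedOver K D ↔ NormAnisotropic (algebraMap ℚ K α) (algebraMap ℚ K β) := by
  have : CharZero K := algebraRat.charZero K
  have hKD : Module.finrank K (K ⊗[ℚ] D) = 4 := Module.finrank_baseChange.trans hD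
  obtain ⟨e⟩ := nonempty_algEquiv_of_basis (by simpa) (by simpa) hKD (basisBaseChange K q)
  have : Nontrivial (K ⊗[ℚ] D) := e.injective.nontrivial
  rw [← forall_isUnit_iff_normAnisotropic, IsRamifiedOver, and_iff_right this]
  refine ⟨fun h x hx ↦ ?_, fun h x hx ↦ ?_⟩
  · simpa using h (e x) (by simpa)
  · simpa using h (e.symm x) (by simpa)

lemma IsRamifiedOver.isDomain (h : IsRamifiedOver K D) : IsDomain D := by
  have := h.1
  have : NoZeroDivisors (K ⊗[ℚ] D) :=
    { eq_zero_or_eq_zero_of_mul_eq_zero {x y} hxy := by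
        by_cases hx : x = 0
        · exact .inl hx
        · exact .inr ((h.2 x hx).mul_right_eq_zero.mp hxy) }
  have hinj : Function.Injective (Algebra.TensorProduct.includeRight : D →ₐ[ℚ] K ⊗[ℚ] D) :=
    Algebra.TensorProduct.includeRight_injective (algebraMap ℚ K).injective
  have : Nontrivial D := RingHom.domain_nontrivial
    (Algebra.TensorProduct.includeRight : D →ₐ[ℚ] K ⊗[ℚ] D).toRingHom
  have := hinj.noZeroDivisors _ (map_zero _) (map_mul _)
  exact NoZeroDivisors.to_isDomain D

end Ramification

section QuaternionAlgebra

variable {F D : Type*} [Field F] [Ring D] [Algebra F D]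

lemma IsQuaternionAlgebra.exists_not_commute (hD : IsQuaternionAlgebra F D) :
    ∃ x y : D, ¬ Commute x y := by
  by_contra! hcomm
  have htop : (⊤ : Subalgebra F D) ≤ Subalgebra.center F D :=
    fun x _ ↦ Subalgebra.mem_center_iff.mpr (hcomm · x)
  have hcenter : (⊤ : Subalgebra F D) = ⊥ := le_bot_iff.mp (htop.trans hD.isCentral.out)
  have : Nontrivial D :=
    Module.nontrivial_of_finrank_pos (R := F) (by simp [hD.finrank_eq_four])
  have := Subalgebra.bot_eq_top_iff_finrank_eq_one.mp hcenter.symm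
  rw [hD.finrank_eq_four] at this
  omega

variable [IsDomain D]

lemma IsQuaternionAlgebra.finrank_adjoin_singleton_le_two (hD : IsQuaternionAlgebra F D) (x : D) :
    Module.finrank F (Algebra.adjoin F {x}) ≤ 2 := by
  have : FiniteDimensional F D := .of_finrank_pos (by simp [hD.finrank_eq_four])
  let K : Subalgebra F D := Algebra.adjoin F {x}
  let _ : DivisionRing K := divisionRingOfFiniteDimensional F K
  have hdvd : Module.finrank F K ∣ 4 :=
    ⟨_, (hD.finrank_eq_four.symm.trans (Module.finrank_mul_finrank F K D).symm)⟩
  have hne : Module.finrank F K ≠ 4 := by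
    intro h
    have htop : K = ⊤ := Subalgebra.toSubmodule_injective
      (Submodule.eq_top_of_finrank_eq (h.trans hD.finrank_eq_four.symm))
    have hcomm (y : D) : Commute x y :=
      Algebra.commute_of_mem_adjoin_self (htop ▸ Algebra.mem_top : y ∈ K)
    obtain ⟨y, z, hyz⟩ := hD.exists_not_commute
    exact hyz (Algebra.commute_of_mem_adjoin_singleton_of_commute
      (htop ▸ Algebra.mem_top : z ∈ K) (hcomm y).symm)
  change Module.finrank F K ≤ 2
  have := Nat.le_of_dvd (by omega) hdvd
  interval_cases Module.finrank F K <;> omega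

lemma IsQuaternionAlgebra.exists_mul_self_eq (hD : IsQuaternionAlgebra F D) (x : D) :
    ∃ t n : F, x * x = t • x + n • (1 : D) := by
  have : FiniteDimensional F D := .of_finrank_pos (by simp [hD.finrank_eq_four])
  let y : Algebra.adjoin F {x} := ⟨x, Algebra.self_mem_adjoin_singleton F x⟩
  have hy : IsIntegral F y := Algebra.IsIntegral.isIntegral y
  have hle := (minpoly.natDegree_le y).trans (hD.finrank_adjoin_singleton_le_two x)
  let f := minpoly F y * Polynomial.X ^ (2 - (minpoly F y).natDegree)
  have hmonic : f.Monic := (minpoly.monic hy).mul (Polynomial.monic_X_pow _)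
  have hdeg : f.natDegree = 2 := by
    rw [(minpoly.monic hy).natDegree_mul (Polynomial.monic_X_pow _), Polynomial.natDegree_X_pow]
    omega
  have hroot : Polynomial.aeval y f = 0 := by simp [f]
  have hlead : f.coeff 2 = 1 := hdeg ▸ hmonic.coeff_natDegree
  rw [Polynomial.aeval_eq_sum_range, hdeg] at hroot
  have hx : f.coeff 0 • (1 : D) + f.coeff 1 • x + x * x = 0 := by
    simpa [Finset.sum_range_succ, hlead, pow_two, y] using congrArg Subtype.val hroot
  exact ⟨-f.coeff 1, -f.coeff 0, by linear_combination (norm := module) hx⟩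

variable [NeZero (2 : F)]

lemma IsQuaternionAlgebra.exists_scalar_square_not_commute (hD : IsQuaternionAlgebra F D) :
    ∃ (i y : D) (α : F), i * i = α • (1 : D) ∧ ¬ Commute i y := by
  have h2 : (2 : F) ≠ 0 := NeZero.ne 2
  obtain ⟨x, y, hxy⟩ := hD.exists_not_commute
  obtain ⟨t, n, hx⟩ := hD.exists_mul_self_eq x
  refine ⟨x - (t / 2) • (1 : D), y, n + (t / 2) ^ 2, ?_, fun h ↦ hxy ?_⟩
  · simp only [sub_mul, mul_sub, mul_smul_comm, smul_mul_assoc, one_mul, mul_one, hx]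
    match_scalars <;> field_simp <;> ring
  · simpa using h.add_left (((Commute.one_left y).smul_left (t / 2)))

lemma IsQuaternionAlgebra.exists_basis (hD : IsQuaternionAlgebra F D) :
    ∃ α β : F, α ≠ 0 ∧ β ≠ 0 ∧ Nonempty (Basis D α 0 β) := by
  have h2 : (2 : F) ≠ 0 := NeZero.ne 2
  obtain ⟨i, y, α, hi, hiy⟩ := hD.exists_scalar_square_not_commute
  let j : D := i * y - y * i
  have hi0 : i ≠ 0 := fun h ↦ hiy (h ▸ Commute.zero_left y)
  have hj0 : j ≠ 0 := fun h ↦ hiy (sub_eq_zero.mp h)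
  have hji : j * i = -(i * j) := by
    simp only [j, sub_mul, mul_sub, mul_assoc, hi]
    simp only [← mul_assoc, hi]
    simp
  obtain ⟨t, β, hj⟩ := hD.exists_mul_self_eq j
  have ht : t = 0 := by
    have hcomm : i * (j * j) = (j * j) * i := by
      rw [mul_assoc, hji, mul_neg, ← mul_assoc j i j, hji, neg_mul, neg_neg, mul_assoc]
    simp only [hj, mul_add, add_mul, mul_smul_comm, smul_mul_assoc, one_mul, mul_one,
      hji] at hcomm
    have : (2 * t) • (i * j) = 0 := by linear_combination (norm := module) hcomm
    simpa [h2, hi0, hj0] using this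
  rw [ht, zero_smul, zero_add] at hj
  refine ⟨α, β, ?_, ?_, ⟨⟨i, j, i * j, by simp [hi], hj, rfl, by simp [hji]⟩⟩⟩
  · rintro rfl
    exact hi0 (by simpa using hi)
  · rintro rfl
    exact hj0 (by simpa using hj)

end QuaternionAlgebra

lemma NormAnisotropic.neg_left {a b : ℝ} (h : NormAnisotropic a b) : a < 0 := by
  by_contra! ha
  refine not_normAnisotropic (√a) 1 0 0 (by simp) ?_ h
  linear_combination Real.sq_sqrt ha

lemma NormAnisotropic.neg_right {a b : ℝ} (h : NormAnisotropic a b) : b < 0 := by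
  by_contra! hb
  refine not_normAnisotropic (√b) 0 1 0 (by simp) ?_ h
  linear_combination Real.sq_sqrt hb

lemma index_le_card_of_forall_exists_inv_mul_mem {G : Type*} [Group G] {H : Subgroup G}
    (s : Finset G) (hs : ∀ g, ∃ a ∈ s, a⁻¹ * g ∈ H) : H.index ≤ s.card := by
  refine Subgroup.index_le_of_leftCoset_cover_const (g := id) (Set.eq_univ_of_forall fun g ↦ ?_)
  simpa [mem_leftCoset_iff] using hs g

section TraceFunction

/-- An integer-valued function with the formal properties of the trace on a finite group of
elements of reduced norm `1` in a definite quaternion algebra over `ℚ`. -/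
structure IsTraceFunction {G : Type*} [Group G] (τ : G → ℤ) : Prop where
  neg_two_le : ∀ x, -2 ≤ τ x
  le_two : ∀ x, τ x ≤ 2
  map_mul_comm : ∀ x y, τ (x * y) = τ (y * x)
  map_mul_add_map_mul_inv : ∀ x y, τ (x * y) + τ (x * y⁻¹) = τ x * τ y
  eq_two_iff : ∀ x, τ x = 2 ↔ x = 1

namespace IsTraceFunction

variable {G : Type*} [Group G] {τ : G → ℤ} (hτ : IsTraceFunction τ) {x y : G}

include hτ

lemma map_one : τ 1 = 2 := (hτ.eq_two_iff 1).mpr rfl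

lemma map_inv (x : G) : τ x⁻¹ = τ x := by
  have := hτ.map_mul_add_map_mul_inv 1 x
  rw [one_mul, one_mul, hτ.map_one] at this
  omega

lemma map_conj (g x : G) : τ (g * x * g⁻¹) = τ x := by
  rw [hτ.map_mul_comm, inv_mul_cancel_left]

lemma map_mul_self (x : G) : τ (x * x) = τ x ^ 2 - 2 := by
  have := hτ.map_mul_add_map_mul_inv x x
  rw [mul_inv_cancel, hτ.map_one] at this
  linarith

/-- Fricke's formula. -/
lemma map_commutator (x y : G) :
    τ ⁅x, y⁆ = τ x ^ 2 + τ y ^ 2 + τ (x * y) ^ 2 - τ x * τ y * τ (x * y) - 2 := by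
  have hcomm := hτ.map_mul_add_map_mul_inv x (y * x⁻¹ * y⁻¹)
  have hmul := hτ.map_mul_add_map_mul_inv (x * y) (x * y⁻¹)
  have hcross : τ (x * (y * x⁻¹ * y⁻¹)⁻¹) = τ (x * y * (x * y⁻¹)) := by group
  have hsq : τ (x * y * (x * y⁻¹)⁻¹) = τ y ^ 2 - 2 := by
    rw [← hτ.map_mul_self y, ← hτ.map_conj x (y * y)]
    group
  have hbracket : τ (x * (y * x⁻¹ * y⁻¹)) = τ ⁅x, y⁆ := by
    rw [commutatorElement_def]
    group
  rw [hbracket, hτ.map_conj, hτ.map_inv, hcross] at hcomm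
  rw [hsq] at hmul
  linear_combination hcomm - hmul - τ (x * y) * hτ.map_mul_add_map_mul_inv x y

lemma four_mul_map_commutator_sub_two (x y : G) :
    4 * (τ ⁅x, y⁆ - 2) =
      (2 * τ (x * y) - τ x * τ y) ^ 2 - (4 - τ x ^ 2) * (4 - τ y ^ 2) := by
  rw [hτ.map_commutator]
  ring

lemma commute_iff : Commute x y ↔ τ ⁅x, y⁆ = 2 := by
  rw [hτ.eq_two_iff, commutatorElement_eq_one_iff_commute]

lemma commute_of_sq_eq_four (hx : τ x ^ 2 = 4) (y : G) : Commute x y := by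
  rw [hτ.commute_iff]
  have := hτ.four_mul_map_commutator_sub_two x y
  rw [hx] at this
  nlinarith [hτ.le_two ⁅x, y⁆, sq_nonneg (2 * τ (x * y) - τ x * τ y)]

lemma two_mul_map_mul_of_sq_eq_four (hx : τ x ^ 2 = 4) (y : G) :
    2 * τ (x * y) = τ x * τ y := by
  have := hτ.four_mul_map_commutator_sub_two x y
  rw [hτ.commute_iff.mp (hτ.commute_of_sq_eq_four hx y), hx] at this
  exact sub_eq_zero.mp (pow_eq_zero_iff two_ne_zero |>.mp (by linarith))

lemma mul_eq_one_of_eq_neg_two (hx : τ x = -2) (hy : τ y = -2) : x * y = 1 := by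
  have := hτ.two_mul_map_mul_of_sq_eq_four (x := x) (by rw [hx]; rfl) y
  rw [hx, hy] at this
  exact (hτ.eq_two_iff _).mp (by omega)

lemma sq_eq_four_or_mem_Icc (x : G) : τ x ^ 2 = 4 ∨ τ x ∈ Finset.Icc (-1) 1 := by
  have h₁ := hτ.neg_two_le x
  have h₂ := hτ.le_two x
  interval_cases τ x <;> simp

lemma mem_Icc_of_not_commute (hxy : ¬ Commute x y) :
    τ x ∈ Finset.Icc (-1) 1 ∧ τ y ∈ Finset.Icc (-1) 1 ∧ τ (x * y) ∈ Finset.Icc (-1) 1 := by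
  refine ⟨(hτ.sq_eq_four_or_mem_Icc x).resolve_left fun h ↦ hxy (hτ.commute_of_sq_eq_four h y),
    (hτ.sq_eq_four_or_mem_Icc y).resolve_left fun h ↦ hxy (hτ.commute_of_sq_eq_four h x).symm,
    (hτ.sq_eq_four_or_mem_Icc _).resolve_left fun h ↦ hxy ?_⟩
  have := (hτ.commute_of_sq_eq_four h x).eq
  rw [mul_assoc] at this
  exact (mul_left_cancel this).symm

lemma map_commutator_cases_of_not_commute (hxy : ¬ Commute x y) :
    τ ⁅x, y⁆ = -2 ∧ τ x = 0 ∨ τ ⁅x, y⁆ = -1 ∧ (τ x = 0 ∨ τ y = 0) ∨ τ ⁅x, y⁆ = 0 := by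
  have hne := mt hτ.commute_iff.mpr hxy
  obtain ⟨hx, hy, hmul⟩ := hτ.mem_Icc_of_not_commute hxy
  rw [hτ.map_commutator] at hne ⊢
  rw [Finset.mem_Icc] at hx hy hmul
  obtain ⟨hx₁, hx₂⟩ := hx
  obtain ⟨hy₁, hy₂⟩ := hy
  obtain ⟨h₁, h₂⟩ := hmul
  interval_cases τ x <;> interval_cases τ y <;> interval_cases τ (x * y) <;> omega

/-- The elements of trace `±2`, that is, the elements `±1` of a quaternion algebra. -/
def signSubgroup : Subgroup G where
  carrier := {x | τ x ^ 2 = 4}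
  one_mem' := by simp [hτ.map_one]
  mul_mem' {x y} (hx : τ x ^ 2 = 4) (hy : τ y ^ 2 = 4) := by
    have := congrArg (· ^ 2) (hτ.two_mul_map_mul_of_sq_eq_four hx y)
    simp only [mul_pow, hx, hy] at this
    exact mul_left_cancel₀ four_ne_zero this
  inv_mem' {x} hx := by rwa [Set.mem_ofPred_eq, hτ.map_inv]

lemma mem_signSubgroup : x ∈ hτ.signSubgroup ↔ τ x ^ 2 = 4 := Iff.rfl

/-- The elements of even trace, when all commutators have even trace. -/
def evenSubgroup (heven : ∀ x y : G, Even (τ ⁅x, y⁆)) : Subgroup G where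
  carrier := {x | Even (τ x)}
  one_mem' := by simp [hτ.map_one]
  mul_mem' {x y} (hx : Even (τ x)) (hy : Even (τ y)) := by
    have := heven x y
    rw [hτ.map_commutator] at this
    simpa [Int.even_sub, Int.even_add, Int.even_pow, Int.even_mul, hx, hy] using this
  inv_mem' {x} hx := by rwa [Set.mem_ofPred_eq, hτ.map_inv]

lemma index_evenSubgroup_le_three (heven : ∀ x y : G, Even (τ ⁅x, y⁆)) :
    (hτ.evenSubgroup heven).index ≤ 3 := by
  classical
  by_cases htop : ∀ a, Even (τ a)
  · rw [Subgroup.index_eq_one.mpr (eq_top_iff.mpr fun a _ ↦ htop a)]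
    omega
  push Not at htop
  obtain ⟨a, ha⟩ := htop
  refine (index_le_card_of_forall_exists_inv_mul_mem {1, a, a⁻¹} fun g ↦ ?_).trans
    Finset.card_le_three
  by_cases hg : Even (τ g)
  · exact ⟨1, by simp, by rwa [inv_one, one_mul]⟩
  have hsum : Odd (τ (g * a) + τ (g * a⁻¹)) := by
    rw [hτ.map_mul_add_map_mul_inv]
    exact (Int.not_even_iff_odd.mp hg).mul (Int.not_even_iff_odd.mp ha)
  rw [hτ.map_mul_comm, hτ.map_mul_comm g] at hsum
  by_cases h : Even (τ (a⁻¹ * g))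
  · exact ⟨a, by simp, h⟩
  · refine ⟨a⁻¹, by simp, ?_⟩
    rw [inv_inv]
    exact (Int.odd_add'.mp hsum).mp (Int.not_even_iff_odd.mp h)

section Even

variable (heven : ∀ x, Even (τ x))
include heven

lemma notMem_signSubgroup_iff : x ∉ hτ.signSubgroup ↔ τ x = 0 := by
  have hx := heven x
  have h₁ := hτ.neg_two_le x
  have h₂ := hτ.le_two x
  rw [mem_signSubgroup]
  interval_cases τ x <;> simp_all

lemma map_mul_eq_zero (hx : x ∉ hτ.signSubgroup) (hxy : x⁻¹ * y ∉ hτ.signSubgroup) :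
    τ (x * y) = 0 := by
  rw [hτ.notMem_signSubgroup_iff heven] at hx hxy
  have := hτ.map_mul_add_map_mul_inv y x
  rw [hτ.map_mul_comm y, hτ.map_mul_comm y, hxy, hx] at this
  simpa using this

lemma map_commutator_eq_neg_two (hx : x ∉ hτ.signSubgroup) (hy : y ∉ hτ.signSubgroup)
    (hxy : x⁻¹ * y ∉ hτ.signSubgroup) : τ ⁅x, y⁆ = -2 := by
  have hmul := hτ.map_mul_eq_zero heven hx hxy
  rw [hτ.notMem_signSubgroup_iff heven] at hx hy
  rw [hτ.map_commutator, hx, hy, hmul]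
  rfl

/-- An element incongruent to `1`, `x`, `y` and `x * y` modulo the sign subgroup anticommutes
with `x`, with `y` and with `x * y`, which is absurd. -/
lemma exists_inv_mul_mem_signSubgroup (hx : x ∉ hτ.signSubgroup) (hy : y ∉ hτ.signSubgroup)
    (hxy : x⁻¹ * y ∉ hτ.signSubgroup) (g : G) :
    g ∈ hτ.signSubgroup ∨ x⁻¹ * g ∈ hτ.signSubgroup ∨ y⁻¹ * g ∈ hτ.signSubgroup ∨
      (x * y)⁻¹ * g ∈ hτ.signSubgroup := by
  by_contra! hg
  obtain ⟨hg, hxg, hyg, hxyg⟩ := hg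
  have hmul : x * y ∉ hτ.signSubgroup :=
    (hτ.notMem_signSubgroup_iff heven).mpr (hτ.map_mul_eq_zero heven hx hxy)
  have hprod : ⁅x * y, g⁆ = x * ⁅y, g⁆ * x⁻¹ * ⁅x, g⁆ := by
    simp only [commutatorElement_def]
    group
  have hone : ⁅x * y, g⁆ = 1 := by
    rw [hprod]
    exact hτ.mul_eq_one_of_eq_neg_two
      (by rw [hτ.map_conj, hτ.map_commutator_eq_neg_two heven hy hg hyg])
      (hτ.map_commutator_eq_neg_two heven hx hg hxg)
  have := hτ.map_commutator_eq_neg_two heven hmul hg hxyg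
  rw [hone, hτ.map_one] at this
  omega

lemma index_signSubgroup_le_four : hτ.signSubgroup.index ≤ 4 := by
  classical
  by_cases h₁ : ∃ x, x ∉ hτ.signSubgroup
  swap
  · push Not at h₁
    rw [Subgroup.index_eq_one.mpr (eq_top_iff.mpr fun a _ ↦ h₁ a)]
    omega
  obtain ⟨x, hx⟩ := h₁
  by_cases h₂ : ∃ y, y ∉ hτ.signSubgroup ∧ x⁻¹ * y ∉ hτ.signSubgroup
  swap
  · push Not at h₂
    refine (index_le_card_of_forall_exists_inv_mul_mem {1, x} fun g ↦ ?_).trans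
      (Finset.card_le_two.trans (by omega))
    by_cases hg : g ∈ hτ.signSubgroup
    · exact ⟨1, by simp, by simpa using hg⟩
    · exact ⟨x, by simp, h₂ g hg⟩
  obtain ⟨y, hy, hxy⟩ := h₂
  refine (index_le_card_of_forall_exists_inv_mul_mem {1, x, y, x * y} fun g ↦ ?_).trans
    Finset.card_le_four
  simpa using hτ.exists_inv_mul_mem_signSubgroup heven hx hy hxy g

end Even

lemma restrict (H : Subgroup G) : IsTraceFunction fun x : H ↦ τ x where
  neg_two_le x := hτ.neg_two_le x
  le_two x := hτ.le_two x
  map_mul_comm x y := hτ.map_mul_comm x y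
  map_mul_add_map_mul_inv x y := hτ.map_mul_add_map_mul_inv x y
  eq_two_iff x := (hτ.eq_two_iff x).trans OneMemClass.coe_eq_one

lemma index_signSubgroup_le_twelve (heven : ∀ x y : G, Even (τ ⁅x, y⁆)) :
    hτ.signSubgroup.index ≤ 12 := by
  have hle : hτ.signSubgroup ≤ hτ.evenSubgroup heven := fun x hx ↦ by
    have h : Even (τ x ^ 2) := (hτ.mem_signSubgroup.mp hx) ▸ (by decide)
    exact (Int.even_pow.mp h).1
  calc hτ.signSubgroup.index
      = hτ.signSubgroup.relIndex (hτ.evenSubgroup heven) * (hτ.evenSubgroup heven).index :=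
        (Subgroup.relIndex_mul_index hle).symm
    _ ≤ 4 * 3 := Nat.mul_le_mul ((hτ.restrict _).index_signSubgroup_le_four fun x ↦ x.2)
        (hτ.index_evenSubgroup_le_three heven)

section CommutatorTraceNegOne

variable (hcomm : ∀ x y : G, ¬ Commute x y → τ ⁅x, y⁆ = -1)
include hcomm

lemma commute_of_map_ne_zero (hx : τ x ≠ 0) (hy : τ y ≠ 0) : Commute x y := by
  by_contra hxy
  have h := hcomm x y hxy
  have := hτ.map_commutator_cases_of_not_commute hxy
  omega

lemma map_mul_ne_zero (hx : τ x ≠ 0) (hy : τ y ≠ 0) : τ (x * y) ≠ 0 := by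
  intro hmul
  have h := hτ.commute_iff.mp (hτ.commute_of_map_ne_zero hcomm hx hy)
  rw [hτ.map_commutator, hmul] at h
  have := hτ.neg_two_le x
  have := hτ.le_two x
  have := hτ.neg_two_le y
  have := hτ.le_two y
  interval_cases τ x <;> interval_cases τ y <;> omega

lemma map_mul_ne_zero_of_eq_zero (hx : τ x = 0) (hy : τ y = 0) : τ (x * y) ≠ 0 := by
  intro hmul
  have h : τ ⁅x, y⁆ = -2 := by rw [hτ.map_commutator, hx, hy, hmul]; rfl
  have hncomm : ¬ Commute x y := by rw [hτ.commute_iff, h]; decide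
  rw [hcomm x y hncomm] at h
  omega

/-- The elements of nonzero trace, when noncommuting elements have commutators of trace `-1`. -/
def nonzeroSubgroup : Subgroup G where
  carrier := {x | τ x ≠ 0}
  one_mem' := by simp [hτ.map_one]
  mul_mem' := hτ.map_mul_ne_zero hcomm
  inv_mem' {x} hx := by rwa [Set.mem_ofPred_eq, hτ.map_inv]

lemma index_nonzeroSubgroup_le_two : (hτ.nonzeroSubgroup hcomm).index ≤ 2 := by
  classical
  by_cases htop : ∀ a, τ a ≠ 0
  · rw [Subgroup.index_eq_one.mpr (eq_top_iff.mpr fun a _ ↦ htop a)]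
    omega
  push Not at htop
  obtain ⟨a, ha⟩ := htop
  refine (index_le_card_of_forall_exists_inv_mul_mem {1, a} fun g ↦ ?_).trans Finset.card_le_two
  by_cases hg : τ g = 0
  · exact ⟨a, by simp, hτ.map_mul_ne_zero_of_eq_zero hcomm (by rwa [hτ.map_inv]) hg⟩
  · exact ⟨1, by simp, by rwa [inv_one, one_mul]⟩

end CommutatorTraceNegOne

lemma exists_normal_abelian_index_le_twelve (heven : ∀ x y : G, Even (τ ⁅x, y⁆)) :
    ∃ N : Subgroup G, N.Normal ∧ (∀ x ∈ N, ∀ y ∈ N, x * y = y * x) ∧ N.index ≤ 12 :=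
  ⟨hτ.signSubgroup, ⟨fun x hx g ↦ by rwa [mem_signSubgroup, hτ.map_conj]⟩,
    fun _ hx y _ ↦ hτ.commute_of_sq_eq_four hx y, hτ.index_signSubgroup_le_twelve heven⟩

lemma exists_normal_abelian_index_le_two (hcomm : ∀ x y : G, ¬ Commute x y → τ ⁅x, y⁆ = -1) :
    ∃ N : Subgroup G, N.Normal ∧ (∀ x ∈ N, ∀ y ∈ N, x * y = y * x) ∧ N.index ≤ 2 :=
  ⟨hτ.nonzeroSubgroup hcomm,
    ⟨fun x hx g ↦ (hτ.map_conj g x).trans_ne hx⟩,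
    fun _ hx _ hy ↦ hτ.commute_of_map_ne_zero hcomm hx hy, hτ.index_nonzeroSubgroup_le_two hcomm⟩

end IsTraceFunction
end TraceFunction

lemma isIntegral_map_add_map {G A : Type*} [Monoid G] [Finite G] [Ring A] (φ : G →* A)
    (x y : G) : IsIntegral ℤ (φ x + φ y) := by
  simpa using (Algebra.IsIntegral.isIntegral (R := ℤ)
    (MonoidAlgebra.of ℤ G x + MonoidAlgebra.of ℤ G y)).map (MonoidAlgebra.lift ℤ A G φ)

section DefiniteQuaternions

lemma re_sq_le_reducedNorm {α β : ℚ} (hα : α < 0) (hβ : β < 0) (x : ℍ[ℚ,α,0,β]) :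
    x.re ^ 2 ≤ reducedNorm x := by
  rw [reducedNorm_apply]
  nlinarith [mul_nonneg (neg_pos.mpr hα).le (sq_nonneg x.imI),
    mul_nonneg (neg_pos.mpr hβ).le (sq_nonneg x.imJ),
    mul_nonneg (mul_pos_of_neg_of_neg hα hβ).le (sq_nonneg x.imK)]

lemma eq_re_of_reducedNorm_eq_re_sq {α β : ℚ} (hα : α < 0) (hβ : β < 0) {x : ℍ[ℚ,α,0,β]}
    (h : reducedNorm x = x.re ^ 2) : x = algebraMap ℚ _ x.re := by
  have h₁ := mul_nonneg (neg_pos.mpr hα).le (sq_nonneg x.imI)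
  have h₂ := mul_nonneg (neg_pos.mpr hβ).le (sq_nonneg x.imJ)
  have h₃ := mul_nonneg (mul_pos_of_neg_of_neg hα hβ).le (sq_nonneg x.imK)
  rw [reducedNorm_apply] at h
  have e₁ : α * x.imI ^ 2 = 0 := by linarith
  have e₂ : β * x.imJ ^ 2 = 0 := by linarith
  have e₃ : α * β * x.imK ^ 2 = 0 := by linarith
  rw [QuaternionAlgebra.algebraMap_eq]
  ext <;> simp_all [hα.ne, hβ.ne]

variable {G : Type*} [Group G] {α β : ℚ}

lemma reducedNorm_map_eq_one [Finite G] (hα : α < 0) (hβ : β < 0) (φ : G →* ℍ[ℚ,α,0,β])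
    (x : G) : reducedNorm (φ x) = 1 := by
  have hpow : reducedNorm (φ x) ^ orderOf x = 1 := by
    rw [← map_pow, ← map_pow, pow_orderOf_eq_one, map_one, map_one]
  exact (pow_eq_one_iff_of_nonneg ((sq_nonneg _).trans (re_sq_le_reducedNorm hα hβ _))
    (orderOf_pos x).ne').mp hpow

lemma map_inv_eq_star (φ : G →* ℍ[ℚ,α,0,β]) {x : G} (hx : reducedNorm (φ x) = 1) :
    φ x⁻¹ = star (φ x) := by
  have hstar : star (φ x) * φ x = 1 := by rw [star_mul_eq_reducedNorm, hx, map_one]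
  calc φ x⁻¹ = star (φ x) * φ x * φ x⁻¹ := by rw [hstar, one_mul]
    _ = star (φ x) := by rw [mul_assoc, ← map_mul, mul_inv_cancel, map_one, mul_one]

lemma exists_int_eq_two_mul_re [Finite G] (φ : G →* ℍ[ℚ,α,0,β]) {x : G}
    (hx : reducedNorm (φ x) = 1) : ∃ t : ℤ, (t : ℚ) = 2 * (φ x).re := by
  have hsum : φ x + φ x⁻¹ = algebraMap ℚ _ (2 * (φ x).re) := by
    rw [map_inv_eq_star φ hx, QuaternionAlgebra.algebraMap_eq]
    ext <;> simp
    ring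
  have hintegral : IsIntegral ℤ (2 * (φ x).re) :=
    (isIntegral_algebraMap_iff (algebraMap ℚ ℍ[ℚ,α,0,β]).injective).mp
      (hsum ▸ isIntegral_map_add_map φ x x⁻¹)
  simpa using IsIntegrallyClosed.isIntegral_iff.mp hintegral

lemma exists_isTraceFunction_of_injective [Finite G] (hα : α < 0) (hβ : β < 0) (φ : G →* ℍ[ℚ,α,0,β])
    (hφ : Function.Injective φ) :
    ∃ τ : G → ℤ, IsTraceFunction τ ∧ ∀ x, (τ x : ℚ) = 2 * (φ x).re := by
  have hnorm := reducedNorm_map_eq_one hα hβ φ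
  choose τ hτ using fun x ↦ exists_int_eq_two_mul_re φ (hnorm x)
  have hle (x : G) : |(φ x).re| ≤ 1 :=
    (sq_le_one_iff_abs_le_one _).mp ((re_sq_le_reducedNorm hα hβ _).trans (hnorm x).le)
  refine ⟨τ, ⟨fun x ↦ ?_, fun x ↦ ?_, fun x y ↦ ?_, fun x y ↦ ?_, fun x ↦ ⟨fun h ↦ ?_, ?_⟩⟩, hτ⟩
  · rw [← Int.cast_le (R := ℚ), hτ]
    push_cast
    linarith [(abs_le.mp (hle x)).1]
  · rw [← Int.cast_le (R := ℚ), hτ]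
    push_cast
    linarith [(abs_le.mp (hle x)).2]
  · rw [← Int.cast_inj (α := ℚ), hτ, hτ]
    simp only [map_mul, QuaternionAlgebra.re_mul]
    ring
  · rw [← Int.cast_inj (α := ℚ)]
    simp only [Int.cast_add, Int.cast_mul, hτ, map_mul, map_inv_eq_star φ (hnorm y),
      QuaternionAlgebra.re_mul, QuaternionAlgebra.re_star, QuaternionAlgebra.imI_star,
      QuaternionAlgebra.imJ_star, QuaternionAlgebra.imK_star]
    ring
  · have hre : (φ x).re = 1 := by
      have := hτ x
      rw [h] at this
      push_cast at this
      linarith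
    apply hφ
    rw [map_one, eq_re_of_reducedNorm_eq_re_sq hα hβ (x := φ x) (by rw [hnorm, hre, one_pow]),
      hre, map_one]
  · rintro rfl
    rw [← Int.cast_inj (α := ℚ), hτ]
    simp

end DefiniteQuaternions

/-- The presentation of a quaternion algebra with generators `x - star x` and `x * y - y * x`,
for `x` and `y` of reduced norm `1`. -/
def commutatorBasis {R : Type*} [CommRing R] {a b : R} (x y : ℍ[R,a,0,b])
    (hx : reducedNorm x = 1) (hy : reducedNorm y = 1) :
    Basis ℍ[R,a,0,b] ((2 * x.re) ^ 2 - 4) 0 (2 * (x * y * star x * star y).re - 2) where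
  i := x - star x
  j := x * y - y * x
  k := (x - star x) * (x * y - y * x)
  i_mul_i := by
    rw [reducedNorm_apply] at hx
    ext <;> simp
    · linear_combination -4 * hx
    all_goals ring
  j_mul_j := by
    have hxy : reducedNorm x * reducedNorm y = 1 := by rw [hx, hy, one_mul]
    rw [reducedNorm_apply, reducedNorm_apply] at hxy
    ext <;> simp
    · linear_combination -2 * hxy
    all_goals ring
  i_mul_j := rfl
  j_mul_i := by ext <;> simp <;> ring

section RamifiedAtPInfty

variable {p : ℕ} {D : Type*} [Ring D] [Algebra ℚ D]

lemma IsQuaternionRamifiedAtPInfty.exists_basis_neg (hD : IsQuaternionRamifiedAtPInfty p D) :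
    ∃ α β : ℚ, α < 0 ∧ β < 0 ∧ Nonempty (Basis D α 0 β) := by
  have := hD.ramified_infty.isDomain
  obtain ⟨α, β, hα, hβ, ⟨q⟩⟩ := hD.isQuaternionAlgebra.exists_basis
  have haniso := (isRamifiedOver_iff_normAnisotropic hα hβ
    hD.isQuaternionAlgebra.finrank_eq_four q).mp hD.ramified_infty
  exact ⟨α, β, by simpa using haniso.neg_left, by simpa using haniso.neg_right, ⟨q⟩⟩

lemma IsQuaternionRamifiedAtPInfty.normAnisotropic_iff (hD : IsQuaternionRamifiedAtPInfty p D)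
    {α β : ℚ} (hα : α ≠ 0) (hβ : β ≠ 0) (q : Basis D α 0 β) (l : ℕ) [Fact l.Prime] :
    NormAnisotropic (α : ℚ_[l]) β ↔ l = p := by
  rw [← hD.ramified_prime_iff l, isRamifiedOver_iff_normAnisotropic hα hβ
    hD.isQuaternionAlgebra.finrank_eq_four q, eq_ratCast, eq_ratCast]

lemma IsQuaternionRamifiedAtPInfty.exists_isTraceFunction [Fact p.Prime]
    (hD : IsQuaternionRamifiedAtPInfty p D) (H : Subgroup Dˣ) [Finite H] :
    ∃ τ : H → ℤ, IsTraceFunction τ ∧ ∀ x y, ¬ Commute x y →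
      NormAnisotropic ((τ x : ℚ_[p]) ^ 2 - 4) ((τ ⁅x, y⁆ : ℚ_[p]) - 2) := by
  obtain ⟨α, β, hα, hβ, ⟨q⟩⟩ := hD.exists_basis_neg
  obtain ⟨e⟩ := nonempty_algEquiv_of_basis hα.ne hβ.ne hD.isQuaternionAlgebra.finrank_eq_four q
  let φ : H →* ℍ[ℚ,α,0,β] := (e.symm : D →* ℍ[ℚ,α,0,β]).comp ((Units.coeHom D).comp H.subtype)
  have hφ : Function.Injective φ :=
    e.symm.injective.comp (Units.val_injective.comp Subtype.val_injective)
  have hnorm := reducedNorm_map_eq_one hα hβ φ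
  obtain ⟨τ, hτ, hre⟩ := exists_isTraceFunction_of_injective hα hβ φ hφ
  refine ⟨τ, hτ, fun x y hxy ↦ ?_⟩
  have hxy₂ : τ ⁅x, y⁆ ≠ 2 := mt hτ.commute_iff.mpr hxy
  have hx₂ : τ x ^ 2 ≠ 4 := fun h ↦ hxy (hτ.commute_of_sq_eq_four h y)
  have hcomm : ((τ ⁅x, y⁆ : ℤ) : ℚ) = 2 * (φ x * φ y * star (φ x) * star (φ y)).re := by
    rw [hre, commutatorElement_def, map_mul, map_mul, map_mul, map_inv_eq_star φ (hnorm x),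
      map_inv_eq_star φ (hnorm y)]
  let q' := (commutatorBasis (φ x) (φ y) (hnorm x) (hnorm y)).compHom (e : ℍ[ℚ,α,0,β] →ₐ[ℚ] D)
  have := (hD.normAnisotropic_iff (by rw [← hre, sub_ne_zero]; exact_mod_cast hx₂)
    (by rw [← hcomm, sub_ne_zero]; exact_mod_cast hxy₂) q' p).mpr rfl
  rw [← hcomm, ← hre] at this
  exact_mod_cast this

end RamifiedAtPInfty

section PadicNormForms

variable {p : ℕ} [Fact p.Prime]

lemma isSquare_padicInt_of_norm_sq_sub_lt (a c : ℤ_[p]) (h : ‖a ^ 2 - c‖ < ‖2 * a‖ ^ 2) :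
    IsSquare (c : ℚ_[p]) := by
  obtain ⟨z, hz, -⟩ := hensels_lemma (R := ℤ_[p]) (F := .X ^ 2 - .C c) (a := a)
    (by simpa [one_add_one_eq_two] using h)
  have hz : z ^ 2 = c := by simpa [sub_eq_zero] using hz
  exact ⟨z, by rw [← hz]; push_cast; ring⟩

lemma isSquare_intCast_padic (hp : p ≠ 2) {c : ℤ} (hc : (c : ZMod p) ≠ 0)
    (h : IsSquare (c : ZMod p)) : IsSquare (c : ℚ_[p]) := by
  obtain ⟨x, hx⟩ := h
  obtain ⟨a, rfl⟩ := ZMod.intCast_surjective x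
  have h2 : (2 : ZMod p) ≠ 0 := Ring.two_ne_zero (by rwa [ZMod.ringChar_zmod_n])
  have ha : ((2 * a : ℤ) : ZMod p) ≠ 0 := by
    rw [hx] at hc
    push_cast
    exact mul_ne_zero h2 (left_ne_zero_of_mul hc)
  have hdvd : (p : ℤ) ∣ a ^ 2 - c := by
    rw [← ZMod.intCast_zmod_eq_zero_iff_dvd]
    push_cast
    rw [hx, sq, sub_self]
  have hunit : ‖((2 * a : ℤ) : ℤ_[p])‖ = 1 :=
    (PadicInt.norm_le_one _).eq_of_not_lt fun hlt ↦ ha <|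
      (ZMod.intCast_zmod_eq_zero_iff_dvd _ _).mpr ((PadicInt.norm_int_lt_one_iff_dvd _).mp hlt)
  refine mod_cast isSquare_padicInt_of_norm_sq_sub_lt (p := p) a c ?_
  rw [show (2 * a : ℤ_[p]) = (2 * a : ℤ) by push_cast; rfl, hunit, one_pow]
  exact mod_cast (PadicInt.norm_int_lt_one_iff_dvd (a ^ 2 - c)).mpr hdvd

lemma exists_sq_eq_neg_seven : ∃ z : ℚ_[2], z ^ 2 = -7 := by
  obtain ⟨z, hz⟩ := isSquare_padicInt_of_norm_sq_sub_lt (p := 2) 1 (-7) (by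
    rw [show (1 : ℤ_[2]) ^ 2 - -7 = ((2 : ℕ) : ℤ_[2]) ^ 3 by norm_num,
      show (2 * 1 : ℤ_[2]) = (2 : ℕ) by norm_num, norm_pow, PadicInt.norm_p]
    norm_num)
  exact ⟨z, by rw [sq, ← hz]; norm_cast⟩

lemma exists_sq_eq_neg_two : ∃ z : ℚ_[3], z ^ 2 = -2 := by
  obtain ⟨z, hz⟩ := isSquare_intCast_padic (p := 3) (by norm_num) (c := -2) (by decide) (by decide)
  exact ⟨z, by rw [sq, ← hz]; norm_cast⟩

lemma not_normAnisotropic_padic_of_units (hp : p ≠ 2) {α β : ℤ} (hα : (α : ZMod p) ≠ 0)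
    (hβ : (β : ZMod p) ≠ 0) : ¬ NormAnisotropic (α : ℚ_[p]) β := by
  have hodd : Fintype.card (ZMod p) % 2 = 1 := by
    rw [ZMod.card]
    exact (Fact.out (p := p.Prime)).eq_two_or_odd.resolve_left hp
  obtain ⟨x, y, hxy⟩ := FiniteField.exists_root_sum_quadratic (f := .X ^ 2)
    (Polynomial.degree_X_pow 2) (Polynomial.degree_quadratic (b := 0) (c := -(β : ZMod p))
      (neg_ne_zero.mpr hα)) hodd
  obtain ⟨b, rfl⟩ := ZMod.intCast_surjective y
  have hxy : x ^ 2 = α * b ^ 2 + β := by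
    simp only [Polynomial.eval_pow, Polynomial.eval_X, Polynomial.eval_add, Polynomial.eval_mul,
      Polynomial.eval_C] at hxy
    linear_combination hxy
  rcases eq_or_ne x 0 with rfl | hx
  · obtain ⟨z, hz⟩ := isSquare_intCast_padic hp (c := -(α * β))
      (by simpa using ⟨hα, hβ⟩) ⟨α * b, by push_cast; linear_combination α * hxy⟩
    have hα₀ : (α : ℚ_[p]) ≠ 0 := fun h ↦ hα (by rw [Int.cast_eq_zero.mp h, Int.cast_zero])
    refine not_normAnisotropic 0 (z / α) 1 0 (by simp) ?_
    push_cast at hz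
    field_simp
    linear_combination hz
  · obtain ⟨z, hz⟩ := isSquare_intCast_padic hp (c := α * b ^ 2 + β)
      (by push_cast; rw [← hxy]; exact pow_ne_zero 2 hx) ⟨x, by push_cast; rw [← hxy, sq]⟩
    refine not_normAnisotropic z b 1 0 (by simp) ?_
    push_cast at hz
    linear_combination -hz

end PadicNormForms

section UpperBounds

variable {p : ℕ} [Fact p.Prime] {D : Type*} [Ring D] [Algebra ℚ D]

lemma IsQuaternionRamifiedAtPInfty.isJordanBound_twelve (hD : IsQuaternionRamifiedAtPInfty 2 D) :
    IsJordanBound Dˣ 12 := by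
  refine ⟨by norm_num, fun H _ ↦ ?_⟩
  obtain ⟨τ, hτ, haniso⟩ := hD.exists_isTraceFunction H
  refine hτ.exists_normal_abelian_index_le_twelve fun x y ↦ ?_
  by_cases hxy : Commute x y
  · rw [hτ.commute_iff.mp hxy]
    exact even_two
  have hne : τ ⁅x, y⁆ ≠ -1 := by
    intro hκ
    have hx : τ x ^ 2 = 0 ∨ τ x ^ 2 = 1 := by
      obtain ⟨h, h'⟩ := Finset.mem_Icc.mp (hτ.mem_Icc_of_not_commute hxy).1
      interval_cases τ x <;> decide
    obtain ⟨z, hz⟩ := exists_sq_eq_neg_seven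
    refine absurd (haniso x y hxy) ?_
    rw [hκ]
    rcases hx with hx | hx <;> rw [← Int.cast_inj (α := ℚ_[2])] at hx <;> push_cast at hx ⊢ <;>
      rw [hx]
    · refine not_normAnisotropic z (1 / 2) 1 (1 / 2) (by simp) ?_
      linear_combination hz
    · refine not_normAnisotropic z 1 1 (1 / 3) (by simp) ?_
      linear_combination hz
  rcases hτ.map_commutator_cases_of_not_commute hxy with ⟨hκ, -⟩ | ⟨hκ, -⟩ | hκ
  · exact hκ ▸ by decide
  · exact absurd hκ hne
  · exact hκ ▸ by decide

lemma IsQuaternionRamifiedAtPInfty.isJordanBound_two (hD : IsQuaternionRamifiedAtPInfty 3 D) :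
    IsJordanBound Dˣ 2 := by
  refine ⟨by norm_num, fun H _ ↦ ?_⟩
  obtain ⟨τ, hτ, haniso⟩ := hD.exists_isTraceFunction H
  refine hτ.exists_normal_abelian_index_le_two fun x y hxy ↦ ?_
  obtain ⟨z, hz⟩ := exists_sq_eq_neg_two
  have hform := haniso x y hxy
  rcases hτ.map_commutator_cases_of_not_commute hxy with ⟨hκ, hx⟩ | ⟨hκ, -⟩ | hκ
  · refine absurd hform (not_normAnisotropic z (1 / 2) (1 / 2) 0 (by simp) ?_)
    rw [hκ, hx]
    push_cast
    linear_combination hz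
  · exact hκ
  · refine absurd hform (not_normAnisotropic z 0 1 0 (by simp) ?_)
    rw [hκ]
    push_cast
    linear_combination hz

lemma IsQuaternionRamifiedAtPInfty.isJordanBound_one (hD : IsQuaternionRamifiedAtPInfty p D)
    (hp : 5 ≤ p) : IsJordanBound Dˣ 1 := by
  refine ⟨one_pos, fun H _ ↦ ?_⟩
  obtain ⟨τ, hτ, haniso⟩ := hD.exists_isTraceFunction H
  have hunit {n : ℤ} (h₀ : n < 0) (h₄ : -4 ≤ n) : (n : ZMod p) ≠ 0 := by
    rw [Ne, ZMod.intCast_zmod_eq_zero_iff_dvd]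
    intro h
    have := Int.le_of_dvd (by omega) ((dvd_neg (b := n)).mpr h)
    omega
  have hcomm (x y : H) : Commute x y := by
    by_contra hxy
    obtain ⟨hx, -⟩ := hτ.mem_Icc_of_not_commute hxy
    rw [Finset.mem_Icc] at hx
    refine not_normAnisotropic_padic_of_units (p := p) (α := τ x ^ 2 - 4) (β := τ ⁅x, y⁆ - 2)
      (by omega) (hunit (by nlinarith) (by nlinarith)) ?_ (mod_cast haniso x y hxy)
    rcases hτ.map_commutator_cases_of_not_commute hxy with ⟨hκ, -⟩ | ⟨hκ, -⟩ | hκ <;>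
      exact hκ ▸ hunit (by norm_num) (by norm_num)
  exact ⟨⊤, inferInstance, fun x _ y _ ↦ hcomm x y, Subgroup.index_top.le⟩

end UpperBounds

section RamificationCriterion

variable {q : ℕ} [Fact q.Prime]

lemma norm_sq_add_mul_sq {a : ℤ} (ha : ¬ IsSquare (-a : ZMod q)) (x y : ℚ_[q]) :
    ‖x ^ 2 + a * y ^ 2‖ = max ‖x‖ ‖y‖ ^ 2 := by
  rcases lt_or_ge ‖y‖ ‖x‖ with hlt | hle
  · have hsq : ‖a * y ^ 2‖ < ‖x ^ 2‖ := by
      rw [norm_mul, norm_pow, norm_pow]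
      calc ‖(a : ℚ_[q])‖ * ‖y‖ ^ 2 ≤ ‖y‖ ^ 2 :=
            mul_le_of_le_one_left (sq_nonneg _) (Padic.norm_int_le_one a)
        _ < ‖x‖ ^ 2 := by gcongr
    rw [Padic.add_eq_max_of_ne hsq.ne', max_eq_left hsq.le, max_eq_left hlt.le, norm_pow]
  · rcases eq_or_ne y 0 with rfl | hy
    · simp_all
    let u : ℤ_[q] := ⟨x / y, by rw [norm_div]; exact div_le_one_of_le₀ hle (norm_nonneg _)⟩
    have hu : ‖u ^ 2 + a‖ = 1 := by
      refine (PadicInt.norm_le_one _).eq_of_not_lt fun hlt ↦ ha ?_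
      have hker : u ^ 2 + a ∈ RingHom.ker (PadicInt.toZMod (p := q)) := by
        rwa [PadicInt.ker_toZMod, IsLocalRing.mem_maximalIdeal, PadicInt.mem_nonunits]
      rw [RingHom.mem_ker, map_add, map_pow, map_intCast] at hker
      exact ⟨PadicInt.toZMod u, by linear_combination -hker⟩
    have hu' : ‖(x / y) ^ 2 + a‖ = 1 := hu
    calc ‖x ^ 2 + a * y ^ 2‖ = ‖((x / y) ^ 2 + a) * y ^ 2‖ := by congr 1; field_simp
      _ = max ‖x‖ ‖y‖ ^ 2 := by rw [norm_mul, hu', one_mul, norm_pow, max_eq_right hle]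

lemma norm_sq_ne_norm_prime (x : ℚ_[q]) : ‖x‖ ^ 2 ≠ ‖(q : ℚ_[q])‖ := by
  have hq : 1 < (q : ℝ) := mod_cast (Fact.out (p := q.Prime)).one_lt
  rcases eq_or_ne x 0 with rfl | hx
  · simpa using (zero_lt_one.trans hq).ne
  · rw [Padic.norm_eq_zpow_neg_valuation hx, Padic.norm_p, ← zpow_natCast, ← zpow_mul,
      ← zpow_neg_one]
    intro h
    have := zpow_right_injective₀ (zero_lt_one.trans hq) hq.ne' h
    omega

/-- The norms of `r² + ax²` and `y² + az²` are even powers of `q`, that of `b` is an odd one. -/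
lemma normAnisotropic_padic_of_not_isSquare {a b : ℤ} (ha : ¬ IsSquare (-a : ZMod q))
    (hb : (q : ℤ) ∣ b) (hb' : ¬ (q : ℤ) ^ 2 ∣ b) : NormAnisotropic (-a : ℚ_[q]) (-b) := by
  obtain ⟨c, rfl⟩ := hb
  have hc : ‖(c : ℚ_[q])‖ = 1 := (Padic.norm_int_le_one c).eq_of_not_lt fun hlt ↦
    hb' (by rw [sq]; exact mul_dvd_mul_left _ (Padic.norm_intCast_lt_one_iff.mp hlt))
  intro x hx
  rw [reducedNorm_apply] at hx
  push_cast at hx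
  have key : max ‖x.re‖ ‖x.imI‖ ^ 2 = ‖(q : ℚ_[q])‖ * max ‖x.imJ‖ ‖x.imK‖ ^ 2 := by
    rw [← norm_sq_add_mul_sq ha, ← norm_sq_add_mul_sq ha, ← mul_one ‖(q : ℚ_[q])‖, ← hc,
      ← norm_mul, ← norm_mul, ← norm_neg]
    congr 1
    linear_combination -hx
  have hmax (v w : ℚ_[q]) : ∃ t : ℚ_[q], ‖t‖ = max ‖v‖ ‖w‖ := by
    rcases max_choice ‖v‖ ‖w‖ with h | h <;> exact ⟨_, h.symm⟩
  obtain ⟨t, ht⟩ := hmax x.re x.imI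
  obtain ⟨s, hs⟩ := hmax x.imJ x.imK
  have hs₀ : s = 0 := by
    by_contra hne
    refine norm_sq_ne_norm_prime (t / s) ?_
    rw [norm_div, div_pow, ht, key, hs, mul_div_cancel_right₀]
    rw [← hs]
    exact pow_ne_zero 2 (norm_ne_zero_iff.mpr hne)
  rw [← ht, ← hs, hs₀, norm_zero, zero_pow two_ne_zero, mul_zero, sq_eq_zero_iff] at key
  rw [hs₀, norm_zero] at hs
  rw [key] at ht
  have hzero {v w : ℚ_[q]} (h : 0 = max ‖v‖ ‖w‖) : v = 0 ∧ w = 0 :=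
    ⟨norm_le_zero_iff.mp (h ▸ le_max_left _ _), norm_le_zero_iff.mp (h ▸ le_max_right _ _)⟩
  exact QuaternionAlgebra.ext (hzero ht).1 (hzero ht).2 (hzero hs).1 (hzero hs).2

end RamificationCriterion

section ChangeOfPresentation

variable {R A : Type*} [CommRing R] [Ring A] [Algebra R A] {α β : R}

/-- The presentation with the roles of `i` and `j` exchanged. -/
def basisSwap (q : Basis A α 0 β) : Basis A β 0 α where
  i := q.j
  j := q.i
  k := -q.k
  i_mul_i := by simp
  j_mul_j := by simp
  i_mul_j := by simp
  j_mul_i := by simp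

/-- The presentation with `j` replaced by `(x + y * i) * j`, which multiplies `β = j ^ 2` by the
norm of `x + y * i`. -/
def basisMulNorm (q : Basis A α 0 β) (x y : R) : Basis A α 0 ((x ^ 2 - α * y ^ 2) * β) where
  i := q.i
  j := x • q.j + y • q.k
  k := x • q.k + (α * y) • q.j
  i_mul_i := q.i_mul_i
  j_mul_j := by
    simp only [mul_add, add_mul, smul_mul_smul_comm, q.j_mul_j, q.j_mul_k, q.k_mul_j, q.k_mul_k]
    module
  i_mul_j := by simp [mul_add, smul_smul, mul_comm]
  j_mul_i := by
    simp only [add_mul, smul_mul_assoc, q.j_mul_i, q.k_mul_i]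
    module

end ChangeOfPresentation

lemma isSquare_zmod_of_squarefree {n : ℕ} (hn : Squarefree n) {c : ℤ}
    (h : ∀ q : ℕ, q.Prime → q ∣ n → IsSquare (c : ZMod q)) : IsSquare (c : ZMod n) := by
  induction n using induction_on_primes with
  | zero => exact absurd hn not_squarefree_zero
  | one => exact ⟨0, Subsingleton.elim _ _⟩
  | prime_mul q n hq ih =>
    obtain ⟨hcop, -, hn'⟩ := Nat.squarefree_mul_iff.mp hn
    obtain ⟨x, hx⟩ := h q hq (dvd_mul_right q n)
    obtain ⟨y, hy⟩ := ih hn' fun r hr hrn ↦ h r hr (hrn.mul_left q)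
    have hprod : IsSquare (c : ZMod q × ZMod n) := ⟨(x, y), Prod.ext hx hy⟩
    simpa only [map_intCast] using hprod.map (ZMod.chineseRemainder hcop).symm

lemma exists_abs_le_half_and_dvd {n : ℕ} [NeZero n] {c : ℤ} (h : IsSquare (c : ZMod n)) :
    ∃ x : ℤ, 2 * |x| ≤ n ∧ (n : ℤ) ∣ x ^ 2 - c := by
  obtain ⟨y, hy⟩ := h
  refine ⟨y.valMinAbs, ?_, ?_⟩
  · have := y.natAbs_valMinAbs_le
    have := Nat.div_mul_le_self n 2
    rw [Int.abs_eq_natAbs]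
    omega
  · rw [← ZMod.intCast_zmod_eq_zero_iff_dvd, Int.cast_sub, Int.cast_pow, ZMod.coe_valMinAbs, hy,
      sq, sub_self]

section Descent

variable {D : Type*} [Ring D] [Algebra ℚ D]

/-- `D` is the quaternion algebra `(-a, -b)` over `ℚ` for the positive integers `a` and `b`, and
`a + b` is as small as possible. -/
structure IsMinimalPresentation (D : Type*) [Ring D] [Algebra ℚ D] (a b : ℕ) : Prop where
  left_pos : 0 < a
  right_pos : 0 < b
  nonempty_basis : Nonempty (Basis D (-a : ℚ) 0 (-b))
  add_le {m n : ℕ} : 0 < m → 0 < n → Nonempty (Basis D (-m : ℚ) 0 (-n)) → a + b ≤ m + n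

namespace IsMinimalPresentation

variable {a b : ℕ}

lemma symm (h : IsMinimalPresentation D a b) : IsMinimalPresentation D b a where
  left_pos := h.right_pos
  right_pos := h.left_pos
  nonempty_basis := h.nonempty_basis.map basisSwap
  add_le hm hn hq := add_comm a b ▸ h.add_le hm hn hq

lemma le_of_norm_mul_eq (h : IsMinimalPresentation D a b) {n : ℕ} (hn : 0 < n) (x y : ℚ)
    (hxy : (x ^ 2 + a * y ^ 2) * b = n) : b ≤ n := by
  obtain ⟨q⟩ := h.nonempty_basis
  have hq : (x ^ 2 - -a * y ^ 2) * -b = (-n : ℚ) := by linear_combination -hxy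
  have := h.add_le h.left_pos hn ⟨hq ▸ basisMulNorm q x y⟩
  omega

lemma squarefree_right (h : IsMinimalPresentation D a b) : Squarefree b := by
  rintro x ⟨k, rfl⟩
  have hpos := h.right_pos
  have hx : 0 < x := Nat.pos_of_ne_zero (by rintro rfl; simp at hpos)
  have hk : 0 < k := Nat.pos_of_mul_pos_left hpos
  have := h.le_of_norm_mul_eq hk (1 / x) 0 (by push_cast; field_simp; ring)
  have := Nat.le_of_mul_le_mul_right (this.trans_eq (one_mul k).symm) hk
  rw [Nat.isUnit_iff]
  nlinarith

lemma squarefree_left (h : IsMinimalPresentation D a b) : Squarefree a :=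
  h.symm.squarefree_right

/-- Write `b = n k` and `x² + a = n m` with `|x| ≤ n / 2`. Multiplying `-b` by the norm of
`(x + i) / n` gives `-m k`, so `n ≤ m` by minimality. -/
lemma three_mul_sq_le (h : IsMinimalPresentation D a b) {n : ℕ} (hn : n ∣ b)
    (ha : IsSquare ((-a : ℤ) : ZMod n)) : 3 * n ^ 2 ≤ 4 * a := by
  obtain ⟨k, rfl⟩ := hn
  have hn : 0 < n := Nat.pos_of_mul_pos_right h.right_pos
  have hk : 0 < k := Nat.pos_of_mul_pos_left h.right_pos
  have : NeZero n := ⟨hn.ne'⟩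
  obtain ⟨x, hx, m, hm⟩ := exists_abs_le_half_and_dvd ha
  have hm₀ : 0 < m := by
    have ha₀ : (0 : ℤ) < a := mod_cast h.left_pos
    exact pos_of_mul_pos_right (a := (n : ℤ)) (by linarith [sq_nonneg x]) (by positivity)
  lift m to ℕ using hm₀.le
  have hmQ : (x : ℚ) ^ 2 + a = n * m := by
    have : ((x ^ 2 - -a : ℤ) : ℚ) = (n * m : ℤ) := by rw [hm]
    push_cast at this
    linarith
  have hle := h.le_of_norm_mul_eq (n := m * k) (mul_pos (mod_cast hm₀) hk) (x / n) (1 / n) (by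
    push_cast
    field_simp
    linear_combination hmQ)
  have hnm : n ≤ m := Nat.le_of_mul_le_mul_right hle hk
  have hx' : 4 * x ^ 2 ≤ n ^ 2 := by
    rw [← sq_abs x]
    nlinarith [abs_nonneg x]
  zify at hnm ⊢
  nlinarith

lemma eq_one_of_isSquare (h : IsMinimalPresentation D a b) (hab : a ≤ b)
    (hsq : IsSquare ((-a : ℤ) : ZMod b)) : a = 1 ∧ b = 1 := by
  have := h.three_mul_sq_le dvd_rfl hsq
  have := h.left_pos
  constructor <;> nlinarith

end IsMinimalPresentation

lemma exists_isMinimalPresentation {α β : ℚ} (hα : α < 0) (hβ : β < 0) (q : Basis D α 0 β) :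
    ∃ a b, a ≤ b ∧ IsMinimalPresentation D a b := by
  have hclear (γ : ℚ) (hγ : γ < 0) : ∃ n : ℕ, 0 < n ∧ γ.den ^ 2 * γ = -n := by
    have hnum := Rat.num_neg.mpr hγ
    refine ⟨γ.den * γ.num.natAbs, mul_pos γ.den_pos (Int.natAbs_pos.mpr hnum.ne), ?_⟩
    rw [Nat.cast_mul, Nat.cast_natAbs, abs_of_neg hnum]
    push_cast
    linear_combination γ.den * Rat.mul_den_eq_num γ
  obtain ⟨m, hm, hαm⟩ := hclear α hα
  obtain ⟨n, hn, hβn⟩ := hclear β hβ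
  have hq : Nonempty (Basis D (-m : ℚ) 0 (-n)) := by
    have q' := basisMulNorm (basisSwap (basisMulNorm q β.den 0)) α.den 0
    exact ⟨basisSwap (by simpa [hαm, hβn] using q')⟩
  obtain ⟨⟨a, b⟩, ⟨ha, hb, hab⟩, hmin⟩ := exists_minimalFor_of_wellFoundedLT
    (fun s : ℕ × ℕ ↦ 0 < s.1 ∧ 0 < s.2 ∧ Nonempty (Basis D (-s.1 : ℚ) 0 (-s.2)))
    (fun s ↦ s.1 + s.2) ⟨(m, n), hm, hn, hq⟩
  have h : IsMinimalPresentation D a b :=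
    ⟨ha, hb, hab, fun hm hn hmn ↦ (le_total _ _).elim id (hmin (j := (_, _)) ⟨hm, hn, hmn⟩)⟩
  rcases le_total a b with hle | hle
  · exact ⟨a, b, hle, h⟩
  · exact ⟨b, a, hle, h.symm⟩

end Descent

section Normalization

variable {p : ℕ} {D : Type*} [Ring D] [Algebra ℚ D]

lemma IsQuaternionRamifiedAtPInfty.isSquare_neg_of_dvd (hD : IsQuaternionRamifiedAtPInfty p D)
    {a b n : ℕ} (h : IsMinimalPresentation D a b) (hn : n ∣ b)
    (hp : p ∣ n → IsSquare ((-a : ℤ) : ZMod p)) : IsSquare ((-a : ℤ) : ZMod n) := by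
  refine isSquare_zmod_of_squarefree (h.squarefree_right.squarefree_of_dvd hn) fun q hq hqn ↦ ?_
  by_contra hsq
  have : Fact q.Prime := ⟨hq⟩
  have hqb : ¬ (q : ℤ) ^ 2 ∣ b := by
    norm_cast
    rw [sq]
    exact fun hdvd ↦ hq.not_isUnit (h.squarefree_right q hdvd)
  have haniso := normAnisotropic_padic_of_not_isSquare (a := a) (b := b) (q := q)
    (by simpa using hsq) (mod_cast hqn.trans hn) hqb
  obtain ⟨B⟩ := h.nonempty_basis
  obtain rfl : q = p := (hD.normAnisotropic_iff (by simpa using h.left_pos.ne')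
    (by simpa using h.right_pos.ne') B q).mp (mod_cast haniso)
  exact hsq (hp hqn)

lemma IsQuaternionRamifiedAtPInfty.nonempty_basis_neg_one_neg_one
    (hD : IsQuaternionRamifiedAtPInfty 2 D) : Nonempty (Basis D (-1 : ℚ) 0 (-1)) := by
  obtain ⟨α, β, hα, hβ, ⟨q⟩⟩ := hD.exists_basis_neg
  obtain ⟨a, b, hab, h⟩ := exists_isMinimalPresentation hα hβ q
  have hsq (c : ZMod 2) : IsSquare c := by decide +revert
  obtain ⟨rfl, rfl⟩ := h.eq_one_of_isSquare hab (hD.isSquare_neg_of_dvd h dvd_rfl fun _ ↦ hsq _)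
  simpa using h.nonempty_basis

lemma IsQuaternionRamifiedAtPInfty.nonempty_basis_neg_one_neg_three
    (hD : IsQuaternionRamifiedAtPInfty 3 D) : Nonempty (Basis D (-1 : ℚ) 0 (-3)) := by
  obtain ⟨α, β, hα, hβ, ⟨q⟩⟩ := hD.exists_basis_neg
  obtain ⟨a, b, hab, h⟩ := exists_isMinimalPresentation hα hβ q
  by_cases h3 : 3 ∣ b → IsSquare ((-a : ℤ) : ZMod 3)
  · obtain ⟨rfl, rfl⟩ := h.eq_one_of_isSquare hab (hD.isSquare_neg_of_dvd h dvd_rfl h3)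
    obtain ⟨B⟩ := h.nonempty_basis
    have haniso := (hD.normAnisotropic_iff (by norm_num) (by norm_num) B 3).mpr rfl
    refine absurd (mod_cast haniso) (not_normAnisotropic_padic_of_units (p := 3) (α := -1)
      (β := -1) (by norm_num) (by decide) (by decide))
  · push Not at h3
    obtain ⟨⟨n, rfl⟩, hsq⟩ := h3
    have ha : a % 3 = 1 := by
      by_contra hne
      rw [← ZMod.intCast_mod] at hsq
      have : (-a : ℤ) % (3 : ℕ) = 0 ∨ (-a : ℤ) % (3 : ℕ) = 1 := by omega
      rcases this with hmod | hmod <;> exact hsq (hmod ▸ by decide)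
    have h3n : ¬ 3 ∣ n := fun hdvd ↦
      Nat.prime_three.not_isUnit (h.squarefree_right 3 (mul_dvd_mul_left 3 hdvd))
    have hn := h.three_mul_sq_le (dvd_mul_left n 3)
      (hD.isSquare_neg_of_dvd h (dvd_mul_left n 3) fun hdvd ↦ absurd hdvd h3n)
    have hn₀ : 0 < n := Nat.pos_of_mul_pos_left h.right_pos
    have hn₄ : n ≤ 4 := by nlinarith
    interval_cases n
    · obtain rfl : a = 1 := by omega
      simpa using h.nonempty_basis
    · obtain rfl : a = 4 := by omega
      exact absurd h.squarefree_left (by decide)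
    · exact absurd dvd_rfl h3n
    · exact absurd h.squarefree_right (by decide)

end Normalization

section LowerBounds

lemma IsJordanBound.of_injective {G G' : Type*} [Group G] [Group G'] {d : ℕ}
    (h : IsJordanBound G' d) (f : G →* G') (hf : Function.Injective f) : IsJordanBound G d := by
  refine ⟨h.1, fun H _ ↦ ?_⟩
  obtain ⟨N, hN, hcomm, hindex⟩ := h.2 (H.map f) (Finite.of_equiv H (H.equivMapOfInjective f hf))
  let e : H ≃* H.map f := H.equivMapOfInjective f hf
  refine ⟨N.comap e, hN.comap _, fun x hx y hy ↦ e.injective ?_, ?_⟩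
  · rw [map_mul, map_mul]
    exact hcomm _ hx _ hy
  · rwa [N.index_comap_of_surjective e.surjective]

lemma IsJordanBound.card_le_mul {G : Type*} [Group G] {d : ℕ} (h : IsJordanBound G d)
    (H : Subgroup G) [Finite H] :
    Nat.card H ≤ Nat.card {x : H // ∀ g, Commute x (g * x * g⁻¹)} * d := by
  obtain ⟨N, hN, hcomm, hindex⟩ := h.2 H inferInstance
  have hle : Nat.card N ≤ Nat.card {x : H // ∀ g, Commute x (g * x * g⁻¹)} :=
    Nat.card_le_card_of_injective
      (fun x ↦ ⟨x, fun g ↦ hcomm _ x.2 _ (hN.conj_mem _ x.2 g)⟩)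
      fun x y hxy ↦ Subtype.ext (congrArg (fun z ↦ z.1) hxy)
  calc Nat.card H = Nat.card N * N.index := N.card_mul_index.symm
    _ ≤ _ := Nat.mul_le_mul hle hindex

lemma IsJordanBound.card_finset_le_mul {M : Type*} [Monoid M] [StarMul M] [DecidableEq M] {d : ℕ}
    (h : IsJordanBound (unitary M) d) (S : Finset M) (hunit : ∀ x ∈ S, x ∈ unitary M)
    (hone : 1 ∈ S) (hmul : ∀ x ∈ S, ∀ y ∈ S, x * y ∈ S) (hstar : ∀ x ∈ S, star x ∈ S) :
    S.card ≤ {x ∈ S | ∀ g ∈ S, x * (g * x * star g) = g * x * star g * x}.card * d := by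
  let H : Subgroup (unitary M) :=
    { carrier := {u | (u : M) ∈ S}
      one_mem' := hone
      mul_mem' := fun hu hv ↦ hmul _ hu _ hv
      inv_mem' := fun hu ↦ hstar _ hu }
  let e : H ≃ S :=
    { toFun := fun u ↦ ⟨u.1, u.2⟩
      invFun := fun x ↦ ⟨⟨x, hunit x x.2⟩, x.2⟩ }
  have : Finite H := .of_equiv S e.symm
  have hle := h.card_le_mul H
  rw [Nat.card_congr e, Nat.card_eq_fintype_card, Fintype.card_coe] at hle
  refine hle.trans (Nat.mul_le_mul_right d ?_)
  rw [← Fintype.card_coe, ← Nat.card_eq_fintype_card]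
  refine Nat.card_le_card_of_injective (fun x ↦ ⟨x.1.1, Finset.mem_filter.mpr ⟨x.1.2, fun g hg ↦
    congrArg (fun u : H ↦ (u : M)) (x.2 (e.symm ⟨g, hg⟩)).eq⟩⟩) fun x y hxy ↦ ?_
  rw [Subtype.mk.injEq] at hxy
  exact Subtype.ext (Subtype.ext (Subtype.ext hxy))

instance {R : Type*} [DecidableEq R] (a b c : R) : DecidableEq ℍ[R,a,b,c] :=
  (QuaternionAlgebra.equivProd a b c).decidableEq

/-- The elements `(a + bi + cj + dk) / 2` of reduced norm `1` with integers `a ≡ c` and `b ≡ d`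
modulo `2`. They are the `24` Hurwitz units for `n = 1`, and form a dicyclic group of order `12`
for `n = 3`. -/
def halfIntegralUnits (n : ℚ) : Finset ℍ[ℚ,-1,0,-n] :=
  let I : Finset ℤ := {-2, -1, 0, 1, 2}
  {v ∈ I ×ˢ I ×ˢ I ×ˢ I | 2 ∣ v.1 - v.2.2.1 ∧ 2 ∣ v.2.1 - v.2.2.2 ∧
    (v.1 ^ 2 + v.2.1 ^ 2 + n * v.2.2.1 ^ 2 + n * v.2.2.2 ^ 2 : ℚ) = 4}.image
      fun v ↦ ⟨v.1 / 2, v.2.1 / 2, v.2.2.1 / 2, v.2.2.2 / 2⟩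

lemma IsJordanBound.twelve_le_of_unitary {d : ℕ} (h : IsJordanBound (unitary ℍ[ℚ,-1,0,-1]) d) :
    12 ≤ d := by
  have hunit : ∀ x ∈ halfIntegralUnits 1, x ∈ unitary _ := by
    simp only [Unitary.mem_iff]
    decide +kernel
  have hle := h.card_finset_le_mul (halfIntegralUnits 1) hunit
    (hone := by decide +kernel) (hmul := by decide +kernel) (hstar := by decide +kernel)
  have hcard : (halfIntegralUnits 1).card = 24 := by decide +kernel
  have hcomm : {x ∈ halfIntegralUnits 1 | ∀ g ∈ halfIntegralUnits 1,
      x * (g * x * star g) = g * x * star g * x}.card = 2 := by decide +kernel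
  rw [hcard, hcomm] at hle
  lia

lemma IsJordanBound.two_le_of_unitary {d : ℕ} (h : IsJordanBound (unitary ℍ[ℚ,-1,0,-3]) d) :
    2 ≤ d := by
  have hunit : ∀ x ∈ halfIntegralUnits 3, x ∈ unitary _ := by
    simp only [Unitary.mem_iff]
    decide +kernel
  have hle := h.card_finset_le_mul (halfIntegralUnits 3) hunit
    (hone := by decide +kernel) (hmul := by decide +kernel) (hstar := by decide +kernel)
  have hcard : (halfIntegralUnits 3).card = 12 := by decide +kernel
  have hcomm : {x ∈ halfIntegralUnits 3 | ∀ g ∈ halfIntegralUnits 3,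
      x * (g * x * star g) = g * x * star g * x}.card = 6 := by decide +kernel
  rw [hcard, hcomm] at hle
  lia

lemma IsJordanBound.unitary_of_basis {F D : Type*} [Field F] [NeZero (2 : F)] [Ring D]
    [Nontrivial D] [Algebra F D] {α β : F} (hα : α ≠ 0) (hβ : β ≠ 0) (q : Basis D α 0 β) {d : ℕ}
    (h : IsJordanBound Dˣ d) : IsJordanBound (unitary ℍ[F,α,0,β]) d := by
  refine h.of_injective ((Units.map (q.liftHom : ℍ[F,α,0,β] →* D)).comp Unitary.toUnits) ?_
  exact (Units.map_injective (algHom_injective_of_ne_zero hα hβ q.liftHom)).comp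
    Unitary.toUnits_injective

end LowerBounds

section JordanConstant

variable {D : Type*} [Ring D] [Algebra ℚ D]

lemma IsQuaternionRamifiedAtPInfty.isLeast_isJordanBound_twelve
    (hD : IsQuaternionRamifiedAtPInfty 2 D) : IsLeast {d | IsJordanBound Dˣ d} 12 := by
  have := hD.isQuaternionAlgebra.isSimpleRing
  obtain ⟨q⟩ := hD.nonempty_basis_neg_one_neg_one
  exact ⟨hD.isJordanBound_twelve, fun d h ↦
    (h.unitary_of_basis (by norm_num) (by norm_num) q).twelve_le_of_unitary⟩

lemma IsQuaternionRamifiedAtPInfty.isLeast_isJordanBound_two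
    (hD : IsQuaternionRamifiedAtPInfty 3 D) : IsLeast {d | IsJordanBound Dˣ d} 2 := by
  have := hD.isQuaternionAlgebra.isSimpleRing
  obtain ⟨q⟩ := hD.nonempty_basis_neg_one_neg_three
  exact ⟨hD.isJordanBound_two, fun d h ↦
    (h.unitary_of_basis (by norm_num) (by norm_num) q).two_le_of_unitary⟩

lemma IsQuaternionRamifiedAtPInfty.isLeast_isJordanBound_one {p : ℕ} [Fact p.Prime]
    (hD : IsQuaternionRamifiedAtPInfty p D) (hp : 5 ≤ p) : IsLeast {d | IsJordanBound Dˣ d} 1 :=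
  ⟨hD.isJordanBound_one hp, fun _ h ↦ h.1⟩

end JordanConstant

theorem corollaryQ (p : ℕ) (hp : p.Prime) (D : Type*) [Ring D] [Algebra ℚ D]
    (hD : IsQuaternionRamifiedAtPInfty p D) :
    IsJordanGroup Dˣ ∧
      (jordanConstant Dˣ = 12 ↔ p = 2) ∧
      (jordanConstant Dˣ = 2 ↔ p = 3) ∧
      (jordanConstant Dˣ = 1 ↔ 5 ≤ p) := by
  have hcases : p = 2 ∨ p = 3 ∨ 5 ≤ p := by
    have hp4 : p ≠ 4 := by
      rintro rfl
      exact absurd hp (by norm_num)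
    have := hp.two_le
    lia
  have : Fact p.Prime := ⟨hp⟩
  obtain ⟨d, hd, hvalue⟩ : ∃ d, IsLeast {d | IsJordanBound Dˣ d} d ∧
      (p = 2 ∧ d = 12 ∨ p = 3 ∧ d = 2 ∨ 5 ≤ p ∧ d = 1) := by
    rcases hcases with rfl | rfl | h5
    · exact ⟨12, hD.isLeast_isJordanBound_twelve, by simp⟩
    · exact ⟨2, hD.isLeast_isJordanBound_two, by simp⟩
    · exact ⟨1, hD.isLeast_isJordanBound_one h5, by simp [h5]⟩
  have hconst : jordanConstant Dˣ = d := hd.csInf_eq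
  exact ⟨⟨d, hd.1⟩, by lia, by lia, by lia⟩
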